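/- **Conventions.** Graphs are simple and need not be locally finite; a graph is identified with its vertex set, equipped (when connected) with the path metric $d$ for which every edge has length one. For $\delta\in\mathbb R$, a connected graph is *$\delta$-hyperbolic* if $d(x,y)+d(z,w)\le\max\{d(x,z)+d(y,w),\,d(x,w)+d(y,z)\}+2\delta$ for all vertices $x,y,z,w$, and *hyperbolic* if it is $\delta$-hyperbolic for some $\delta$. Let $\mathcal G$ be a connected graph and let $\mathcal H=\{H_c\mid c\in\mathcal C\}$ be a family of connected (non-empty) subgraphs, with path metrics $d_{H_c}$. The subgraphs may in particular be complete in the sense of full (induced) subgraphs, but this is not required. The *electrification* $\mathcal{EG}$ is obtained from $\mathcal G$ by adding, for every $c\in\mathcal C$, a new vertex $v_c$ which is joined by an edge to each vertex of $H_c$ and to no other vertex. For $L>1$, an edge path $\gamma$ in $\mathcal{EG}$ is an *$L$-quasi-geodesic* if $|i-j|/L-L\le d(\gamma(i),\gamma(j))\le L|i-j|+L$ for all $i,j$; it is *efficient* if for every $c$ there is at most one $k$ with $\gamma(k)=v_c$. The graph $\mathcal G$ is *hyperbolic relative to $\mathcal H$* if $\mathcal{EG}$ is hyperbolic and the following *bounded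 penetration property* holds. For every $L>1$ there is $p(L)>0$ such that, whenever $\gamma$ is an efficient $L$-quasi-geodesic in $\mathcal{EG}$ with $\gamma(k)=v_c$ at an interior vertex of the path and $d_{H_c}(\gamma(k-1),\gamma(k+1))\ge p(L)$, every efficient $L$-quasi-geodesic $\gamma'$ in $\mathcal{EG}$ with the same endpoints as $\gamma$ passes through $v_c$, and if $\gamma'(k')=v_c$ then $d_{H_c}(\gamma(k-1),\gamma'(k'-1))\le p(L)$ and $d_{H_c}(\gamma(k+1),\gamma'(k'+1))\le p(L)$. For an integer $K\ge 0$, a *$K$-approximate shortest distance projection* to $H_c$ is a map $\Pi_c$ from $\mathcal G$ to $H_c$ with $d_{\mathcal G}(x,\Pi_c(x))\le d_{\mathcal G}(x,z)+K$ for all vertices $x$ of $\mathcal G$ and $z$ of $H_c$. Given such maps $\Pi_c$, put $$d_a(b,c)=\operatorname{diam}\bigl(\Pi_a(H_b)\cup\Pi_a(H_c)\bigr)\in[0,\infty]\qquad(a,b,c\in\mathcal C),$$ where diameters of subsets of $H_a$ are taken with respect to $d_{H_a}$. **Lemma 2.2.** Let $\mathcal G$ be a hyperbolic graph which is hyperbolic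 relative to a family $\mathcal H=\{H_c\mid c\in\mathcal C\}$ of connected subgraphs, and suppose that there is a number $\delta>0$ such that every $H_c$ is $\delta$-hyperbolic. Then for every integer $K\ge0$ there are numbers $R>0$ and $\theta>0$ such that for every choice of $K$-approximate shortest distance projections $\Pi_c$ to $H_c$ $(c\in\mathcal C)$ the following hold. 1. For all $c\ne d$ in $\mathcal C$, $\operatorname{diam}(\Pi_c(H_d))\le R$. 2. For any triple of distinct elements $a,b,c\in\mathcal C$, at most one of the numbers $d_a(b,c),\,d_b(a,c),\,d_c(a,b)$ is greater than $\theta$. 3. For any $a,b\in\mathcal C$, the set $\{c\in\mathcal C\mid d_c(a,b)>\theta\}$ is finite. -/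

import Mathlib

/-! Graphs are simple graphs, identified with their vertex sets carrying the path metric
(every edge has length one). They need not be locally finite. -/

namespace RelHypGraph

universe u v

/-- Gromov's four-point condition with constant `δ`, for the path metric on the vertices. It is
only used for connected graphs, where `SimpleGraph.dist` is the path metric. -/
def IsDeltaHyperbolic {V : Type u} (G : SimpleGraph V) (δ : ℝ) : Prop :=
  ∀ x y z w : V,
    (G.dist x y : ℝ) + G.dist z w ≤
      max ((G.dist x z : ℝ) + G.dist y w) ((G.dist x w : ℝ) + G.dist y z) + 2 * δ

/-- Hyperbolicity in the sense of Gromov. -/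
def IsHyperbolic {V : Type u} (G : SimpleGraph V) : Prop :=
  ∃ δ : ℝ, IsDeltaHyperbolic G δ

/-- The `H`-electrification of `G`: for every `c` a new vertex `v_c = Sum.inr c` is added, which
is joined by an edge to each vertex of `H c` and to no other vertex. -/
def electrification {V : Type u} {C : Type v} (G : SimpleGraph V) (H : C → G.Subgraph) :
    SimpleGraph (V ⊕ C) where
  Adj p q :=
    match p, q with
    | Sum.inl x, Sum.inl y => G.Adj x y
    | Sum.inl x, Sum.inr c => x ∈ (H c).verts
    | Sum.inr c, Sum.inl x => x ∈ (H c).verts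
    | Sum.inr _, Sum.inr _ => False
  symm := ⟨by
    rintro (x | c) (y | d) h
    · exact G.adj_symm h
    · exact h
    · exact h
    · exact h⟩
  loopless := ⟨by
    rintro (x | c) h
    · exact G.irrefl h
    · exact h⟩

/-- An edge path `γ(0), …, γ(n)` is an `L`-quasi-geodesic if
`|i - j| / L - L ≤ d(γ(i), γ(j)) ≤ L * |i - j| + L` for all `i, j`. -/
def IsQuasiGeodesic {W : Type u} {E : SimpleGraph W} {p q : W} (L : ℝ) (γ : E.Walk p q) : Prop :=
  ∀ i j : ℕ, i ≤ γ.length → j ≤ γ.length →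
    |(i : ℝ) - j| / L - L ≤ E.dist (γ.getVert i) (γ.getVert j) ∧
      (E.dist (γ.getVert i) (γ.getVert j) : ℝ) ≤ L * |(i : ℝ) - j| + L

/-- An edge path in the electrification is efficient if it visits every special vertex `v_c` at
most once. -/
def IsEfficient {V : Type u} {C : Type v} {G : SimpleGraph V} {H : C → G.Subgraph}
    {p q : V ⊕ C} (γ : (electrification G H).Walk p q) : Prop :=
  ∀ (c : C) (i j : ℕ), i ≤ γ.length → j ≤ γ.length →
    γ.getVert i = Sum.inr c → γ.getVert j = Sum.inr c → i = j

/-- `γ(k) = x`, `γ(k+1) = v_c` and `γ(k+2) = y`, where `x` and `y` are vertices of `H c`. (The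
walk `γ` is constant after its last vertex, so this forces `k + 2 ≤ γ.length`.) -/
def Traverses {V : Type u} {C : Type v} {G : SimpleGraph V} {H : C → G.Subgraph}
    {p q : V ⊕ C} (γ : (electrification G H).Walk p q) (c : C) (k : ℕ)
    (x y : (H c).verts) : Prop :=
  γ.getVert k = Sum.inl (x : V) ∧ γ.getVert (k + 1) = Sum.inr c ∧
    γ.getVert (k + 2) = Sum.inl (y : V)

/-- The bounded penetration property. All distances in it are path distances in `H c`. -/
def BoundedPenetration {V : Type u} {C : Type v} (G : SimpleGraph V) (H : C → G.Subgraph) :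
    Prop :=
  ∀ L : ℝ, 1 < L → ∃ P : ℝ, 0 < P ∧
    ∀ (p q : V ⊕ C) (γ : (electrification G H).Walk p q),
      IsEfficient γ → IsQuasiGeodesic L γ →
      ∀ (c : C) (k : ℕ) (x y : (H c).verts), Traverses γ c k x y →
        P ≤ (H c).coe.dist x y →
        ∀ γ' : (electrification G H).Walk p q, IsEfficient γ' → IsQuasiGeodesic L γ' →
          Sum.inr c ∈ γ'.support ∧
          ∀ (k' : ℕ) (x' y' : (H c).verts), Traverses γ' c k' x' y' →
            ((H c).coe.dist x x' : ℝ) ≤ P ∧ ((H c).coe.dist y y' : ℝ) ≤ P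

/-- The connected graph `G` is hyperbolic relative to the family `H` of connected subgraphs. -/
structure IsHyperbolicRelativeTo {V : Type u} {C : Type v} (G : SimpleGraph V)
    (H : C → G.Subgraph) : Prop where
  connected : G.Connected
  connected_peripheral : ∀ c, (H c).Connected
  hyperbolic_electrification : IsHyperbolic (electrification G H)
  bounded_penetration : BoundedPenetration G H

/-- `π` sends every vertex of `G` to a vertex of `S` of shortest distance, up to an additive
error of at most `K`. -/
def IsProjection {V : Type u} {G : SimpleGraph V} (S : G.Subgraph) (K : ℕ) (π : V → S.verts) :
    Prop :=
  ∀ (x : V) (z : S.verts), G.dist x (π x) ≤ G.dist x z + K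

/-- The diameter of a set of vertices of a graph, possibly infinite. -/
noncomputable def setDiam {W : Type u} (E : SimpleGraph W) (S : Set W) : ℕ∞ :=
  ⨆ x ∈ S, ⨆ y ∈ S, E.edist x y

/-- `d_a(b, c) = diam (Π_a(H_b) ∪ Π_a(H_c))`, the diameter being taken in `H_a`. -/
noncomputable def projDist {V : Type u} {C : Type v} {G : SimpleGraph V} (H : C → G.Subgraph)
    (π : ∀ c, V → (H c).verts) (a b c : C) : ℕ∞ :=
  setDiam (H a).coe (π a '' (H b).verts ∪ π a '' (H c).verts)

end RelHypGraph

/-!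
The electrification enters only through *fineness* (`IsFine`): two vertices of `H c` that are joined
in the electrification by a walk of length at most `n` avoiding `v_c` have bounded distance in
`H c`. This is bounded penetration, applied to the walk `x, v_c, y` and to a path missing `v_c`;
walks of bounded length are quasi-geodesics for a trivial reason.

Fineness and hyperbolicity of the electrification imply that the subgraphs `H c` are uniformly
quasiconvex in `G`. Indeed, sending `x` to the vertex at which an electric geodesic from `x` to
`v_c` enters `H c` defines a coarsely Lipschitz retraction of `G` onto `H c`. By thin triangles, the
images of `x` and `y` are far apart only if electric geodesics from `x` to `y` pass through `v_c`;
by fineness, these stay in a `G`-neighbourhood of `x` whose size depends only on the distance of `x`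
and `y` in `G`. Hence the retraction collapses `G`-balls of any given radius, provided that their
centre is far enough from `H c`, and `G`-geodesics with endpoints in `H c` cannot make long
excursions away from `H c` (`IsFine.exists_contracting_retraction`, `isQuasiconvex_of_retraction`).

The rest takes place in the hyperbolic graph `G`. If the projections of `x` and `y` to the
quasiconvex subgraph `H c` are far apart, a geodesic from `x` to `y` passes close to both of them
(`IsProjection.exists_near_getVert`). On the other hand, by fineness two different subgraphs of the
family are close to each other only along sets of bounded diameter (`IsFine.dist_le_of_near`).

* The projection of `H e` to `H c` is bounded, as otherwise a geodesic with endpoints in `H e`,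
  which is close to `H e`, would have a long segment close to `H c`.
* If `π_a y` and `π_a (π_b y)` are far apart, a geodesic from `y` to `π_b y` passes close to
  `π_a y`, and so `y` and the point `π_a y` of `H a` have almost the same projection to `H b`.
* If `π_c x` and `π_c y` are far apart, a fixed geodesic from `x` to `y` has two distant vertices
  close to `H c`, and these two vertices determine `c`.
-/

namespace RelHypGraph

open SimpleGraph

/-! ### Geodesics and thin triangles -/

section Geodesics

variable {W : Type*} {E : SimpleGraph W}

lemma dist_getVert_le_of_le {p q : W} (γ : E.Walk p q) {i j : ℕ} (hij : i ≤ j) :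
    E.dist (γ.getVert i) (γ.getVert j) ≤ j - i := by
  have h := (E.dist_le ((γ.drop i).take (j - i))).trans
    (show _ ≤ j - i by simp [Walk.take_length])
  rwa [Walk.drop_getVert, Nat.add_sub_cancel' hij] at h

lemma dist_getVert_eq_sub (hE : E.Connected) {p q : W} {γ : E.Walk p q}
    (hγ : γ.length = E.dist p q) {i j : ℕ} (hij : i ≤ j) (hj : j ≤ γ.length) :
    E.dist (γ.getVert i) (γ.getVert j) = j - i := by
  have h1 := dist_getVert_le_of_le γ (Nat.zero_le i)
  have h2 := dist_getVert_le_of_le γ hij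
  have h3 := dist_getVert_le_of_le γ hj
  rw [Walk.getVert_zero] at h1
  rw [Walk.getVert_length] at h3
  have h4 := hE.dist_triangle (u := p) (v := γ.getVert i) (w := q)
  have h5 := hE.dist_triangle (u := γ.getVert i) (v := γ.getVert j) (w := q)
  omega

lemma dist_start_getVert (hE : E.Connected) {p q : W} {γ : E.Walk p q}
    (hγ : γ.length = E.dist p q) {i : ℕ} (hi : i ≤ γ.length) : E.dist p (γ.getVert i) = i := by
  simpa using dist_getVert_eq_sub hE hγ (Nat.zero_le i) hi

lemma dist_getVert_end (hE : E.Connected) {p q : W} {γ : E.Walk p q}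
    (hγ : γ.length = E.dist p q) {i : ℕ} (hi : i ≤ γ.length) :
    E.dist (γ.getVert i) q = γ.length - i := by
  simpa using dist_getVert_eq_sub hE hγ hi le_rfl

/-- The four-point condition `IsDeltaHyperbolic` with a natural number as constant, stated for the
distances as natural numbers. -/
def FourPoint (E : SimpleGraph W) (D : ℕ) : Prop :=
  ∀ x y z w : W, E.dist x y + E.dist z w ≤
    max (E.dist x z + E.dist y w) (E.dist x w + E.dist y z) + 2 * D

lemma IsHyperbolic.exists_fourPoint (h : IsHyperbolic E) : ∃ D, FourPoint E D := by
  obtain ⟨δ, hδ⟩ := h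
  obtain ⟨D, hD⟩ := exists_nat_ge δ
  refine ⟨D, fun x y z w ↦ ?_⟩
  have h := hδ x y z w
  have : ((E.dist x y + E.dist z w : ℕ) : ℝ) ≤
      ((max (E.dist x z + E.dist y w) (E.dist x w + E.dist y z) + 2 * D : ℕ) : ℝ) := by
    push_cast
    linarith
  exact_mod_cast this

/-- A point that almost realizes equality in the triangle inequality lies close to every
geodesic. -/
lemma FourPoint.exists_near_getVert {D : ℕ} (hD : FourPoint E D) (hE : E.Connected) {x y u : W}
    {γ : E.Walk x y} (hγ : γ.length = E.dist x y) {m : ℕ}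
    (h : E.dist x u + E.dist u y ≤ E.dist x y + m) :
    ∃ i ≤ γ.length, E.dist u (γ.getVert i) ≤ m + 2 * D := by
  rcases le_total (E.dist x u) γ.length with hu | hu
  · refine ⟨E.dist x u, hu, ?_⟩
    have h1 := dist_start_getVert hE hγ hu
    have h2 := dist_getVert_end hE hγ hu
    have h3 := hD u (γ.getVert (E.dist x u)) x y
    rw [E.dist_comm (u := u) (v := x), E.dist_comm (u := γ.getVert (E.dist x u)) (v := x)] at h3
    omega
  · refine ⟨γ.length, le_rfl, ?_⟩
    rw [Walk.getVert_length]
    omega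

/-- Geodesic triangles are thin. -/
lemma FourPoint.thin_triangle {D : ℕ} (hD : FourPoint E D) (hE : E.Connected) {v x y : W}
    {p : E.Walk v x} (hp : p.length = E.dist v x) {q : E.Walk v y} (hq : q.length = E.dist v y)
    {w : E.Walk x y} (hw : w.length = E.dist x y) {i : ℕ} (hi : i ≤ p.length) :
    (∃ j ≤ q.length, E.dist (p.getVert i) (q.getVert j) ≤ 4 * D) ∨
      ∃ k ≤ w.length, E.dist (p.getVert i) (w.getVert k) ≤ 4 * D := by
  have h1 := dist_start_getVert hE hp hi
  have h2 := dist_getVert_end hE hp hi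
  have h3 := hD (p.getVert i) y v x
  have h4 := E.dist_comm (u := p.getVert i) (v := v)
  have h5 := E.dist_comm (u := p.getVert i) (v := x)
  have h6 := E.dist_comm (u := y) (v := x)
  have h7 := E.dist_comm (u := y) (v := v)
  rcases le_total (E.dist (p.getVert i) v + E.dist y x) (E.dist (p.getVert i) x + E.dist y v)
    with hc | hc
  · rw [max_eq_right hc] at h3
    obtain ⟨j, hj, hj'⟩ := hD.exists_near_getVert hE hq (u := p.getVert i) (m := 2 * D) (by omega)
    exact .inl ⟨j, hj, by omega⟩
  · rw [max_eq_left hc] at h3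
    obtain ⟨j, hj, hj'⟩ := hD.exists_near_getVert hE hw (u := p.getVert i) (m := 2 * D) (by omega)
    exact .inr ⟨j, hj, by omega⟩

/-! ### Short walks that avoid a vertex -/

/-- `Linked E z n p q`: some walk of length at most `n` from `p` to `q` does not visit `z`. -/
def Linked (E : SimpleGraph W) (z : W) (n : ℕ) (p q : W) : Prop :=
  ∃ γ : E.Walk p q, γ.length ≤ n ∧ z ∉ γ.support

namespace Linked

variable {z p q r : W} {m n : ℕ}

lemma mono (h : Linked E z m p q) (hmn : m ≤ n) : Linked E z n p q :=
  let ⟨γ, h1, h2⟩ := h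
  ⟨γ, h1.trans hmn, h2⟩

lemma symm (h : Linked E z n p q) : Linked E z n q p :=
  let ⟨γ, h1, h2⟩ := h
  ⟨γ.reverse, by simpa using h1, by simpa using h2⟩

lemma trans (h : Linked E z m p q) (h' : Linked E z n q r) : Linked E z (m + n) p r := by
  obtain ⟨γ, h1, h2⟩ := h
  obtain ⟨γ', h1', h2'⟩ := h'
  refine ⟨γ.append γ', by rw [Walk.length_append]; omega, ?_⟩
  simp [Walk.mem_support_append_iff, h2, h2']

lemma refl (h : p ≠ z) : Linked E z n p p :=
  ⟨.nil, by simp, by simpa using h.symm⟩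

lemma of_adj (h : E.Adj p q) (hp : p ≠ z) (hq : q ≠ z) : Linked E z 1 p q :=
  ⟨.cons h .nil, by simp, by simp [hp.symm, hq.symm]⟩

/-- A segment of a walk that avoids `z`. -/
lemma segment (γ : E.Walk p q) {i j : ℕ} (hij : i ≤ j) (hj : j ≤ γ.length)
    (h : ∀ k, i ≤ k → k ≤ j → γ.getVert k ≠ z) :
    Linked E z (j - i) (γ.getVert i) (γ.getVert j) := by
  induction j, hij using Nat.le_induction with
  | base => exact refl (h i le_rfl le_rfl)
  | succ j hij ih =>
    have h1 := ih (by omega) fun k hk hk' ↦ h k hk (by omega)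
    exact (h1.trans (of_adj (γ.adj_getVert_succ (by omega)) (h j hij (by omega))
      (h (j + 1) (by omega) le_rfl))).mono (by omega)

lemma of_dist_lt (hE : E.Connected) (h : E.dist p q ≤ n) (hz : n < E.dist z p) :
    Linked E z n p q := by
  obtain ⟨γ, hγ⟩ := hE.exists_walk_length_eq_dist p q
  refine ⟨γ, by omega, fun hmem ↦ ?_⟩
  obtain ⟨k, hk, hk'⟩ := Walk.mem_support_iff_exists_getVert.1 hmem
  have := dist_start_getVert hE hγ hk'
  rw [hk, E.dist_comm] at this
  omega

end Linked

/-- Let `p`, `q` be geodesics from `v` to `x`, `y`, and let the geodesic `w` from `x` to `y` miss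
`v`. The point of `p` at distance about `4 * D` from `v` can be joined to `q` or to `w` by a short
walk missing `v`. -/
lemma FourPoint.exists_linked {D : ℕ} (hD : FourPoint E D) (hE : E.Connected) {v x y : W}
    {p : E.Walk v x} (hp : p.length = E.dist v x) {q : E.Walk v y} (hq : q.length = E.dist v y)
    {w : E.Walk x y} (hw : w.length = E.dist x y) (hv : v ∉ w.support) :
    (∃ j ≤ q.length, 1 ≤ j ∧ j ≤ 8 * D + 1 ∧
      Linked E v (4 * D) (p.getVert (min (4 * D + 1) p.length)) (q.getVert j)) ∨
    ∃ k ≤ w.length,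
      Linked E v (4 * D) (p.getVert (min (4 * D + 1) p.length)) (w.getVert k) := by
  rcases le_total (4 * D + 1) p.length with hl | hl
  · rw [min_eq_left hl]
    have h0 := dist_start_getVert hE hp hl
    rcases hD.thin_triangle hE hp hq hw hl with ⟨j, hj, hj'⟩ | ⟨k, hk, hk'⟩
    · have h1 := dist_start_getVert hE hq hj
      have h2 := hE.dist_triangle (u := v) (v := p.getVert (4 * D + 1)) (w := q.getVert j)
      have h3 := hE.dist_triangle (u := v) (v := q.getVert j) (w := p.getVert (4 * D + 1))
      rw [E.dist_comm (u := q.getVert j)] at h3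
      exact .inl ⟨j, hj, by omega, by omega, .of_dist_lt hE hj' (by omega)⟩
    · exact .inr ⟨k, hk, .of_dist_lt hE hk' (by omega)⟩
  · rw [min_eq_right hl, Walk.getVert_length]
    refine .inr ⟨0, by omega, ?_⟩
    rw [Walk.getVert_zero]
    exact .refl fun h ↦ hv (h ▸ w.start_mem_support)

/-- If a geodesic from `x` to `y` misses `v`, then the first steps of geodesics from `v` to `x` and
to `y` can be joined by a walk of bounded length that misses `v`. -/
lemma FourPoint.linked_first_step {D : ℕ} (hD : FourPoint E D) (hE : E.Connected) {v x y : W}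
    {p : E.Walk v x} (hp : p.length = E.dist v x) {q : E.Walk v y} (hq : q.length = E.dist v y)
    {w : E.Walk x y} (hw : w.length = E.dist x y) (hv : v ∉ w.support) :
    Linked E v (32 * D + 4) (p.getVert 1) (q.getVert 1) := by
  have hseg : ∀ {x' : W} (p' : E.Walk v x'), p'.length = E.dist v x' → ∀ i, 1 ≤ i →
      i ≤ p'.length → Linked E v (i - 1) (p'.getVert 1) (p'.getVert i) := by
    intro x' p' hp' i hi hi'
    refine .segment p' hi hi' fun k hk hk' h ↦ ?_
    have := dist_start_getVert hE hp' (hk'.trans hi')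
    rw [h, dist_self] at this
    omega
  have hx : 1 ≤ p.length := by
    rw [hp]
    exact hE.pos_dist_of_ne fun h ↦ hv (h ▸ w.start_mem_support)
  have hy : 1 ≤ q.length := by
    rw [hq]
    exact hE.pos_dist_of_ne fun h ↦ hv (h ▸ w.end_mem_support)
  have hw' : w.reverse.length = E.dist y x := by rw [Walk.length_reverse, hw, E.dist_comm]
  have hi : min (4 * D + 1) p.length ≤ p.length := min_le_right _ _
  have hi' : min (4 * D + 1) q.length ≤ q.length := min_le_right _ _
  have hp1 := hseg p hp (min (4 * D + 1) p.length) (by omega) hi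
  have hq1 := hseg q hq (min (4 * D + 1) q.length) (by omega) hi'
  rcases hD.exists_linked hE hp hq hw hv with ⟨j, hj, hj1, hj2, h⟩ | ⟨k, hk, h⟩
  · exact ((hp1.trans h).trans (hseg q hq j hj1 hj).symm).mono (by omega)
  rcases hD.exists_linked hE hq hp hw' (by simpa using hv) with ⟨j, hj, hj1, hj2, h'⟩ | ⟨k', hk', h'⟩
  · exact (((hq1.trans h').trans (hseg p hp j hj1 hj).symm).mono (by omega)).symm
  -- Both points are close to `w`; the part of `w` between the two is short.
  rw [Walk.getVert_reverse] at h'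
  obtain ⟨l, hl, hll⟩ : ∃ l ≤ w.length, l = w.length - k' := ⟨_, Nat.sub_le _ _, rfl⟩
  rw [← hll] at h'
  have hdist : ∀ {a b : W} {n : ℕ}, Linked E v n a b → E.dist a b ≤ n := by
    rintro a b n ⟨γ, hγ, -⟩
    exact (E.dist_le γ).trans hγ
  have hvp := dist_start_getVert hE hp hi
  have hvq := dist_start_getVert hE hq hi'
  have hne : ∀ a, w.getVert a ≠ v := fun a ha ↦ hv (ha ▸ w.getVert_mem_support a)
  have hkl : Linked E v (16 * D + 2) (w.getVert k) (w.getVert l) := by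
    have e1 := hdist h
    have e2 := hdist h'
    have t1 := hE.dist_triangle (u := w.getVert k)
      (v := p.getVert (min (4 * D + 1) p.length)) (w := v)
    have t2 := hE.dist_triangle (u := v)
      (v := q.getVert (min (4 * D + 1) q.length)) (w := w.getVert l)
    have t3 := hE.dist_triangle (u := w.getVert k) (v := v) (w := w.getVert l)
    rw [E.dist_comm (u := w.getVert k) (v := p.getVert _),
      E.dist_comm (u := p.getVert _) (v := v)] at t1
    rcases le_total k l with hle | hle
    · have := dist_getVert_eq_sub hE hw hle hl
      exact (Linked.segment w hle hl fun a _ _ ↦ hne a).mono (by omega)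
    · have := dist_getVert_eq_sub hE hw hle hk
      rw [E.dist_comm] at this
      exact (Linked.segment w hle hk fun a _ _ ↦ hne a).symm.mono (by omega)
  exact ((((hp1.trans h).trans hkl).trans h'.symm).trans hq1.symm).mono (by omega)

end Geodesics

/-! ### The electrification -/

section Electrification

variable {V C : Type*} {G : SimpleGraph V} {H : C → G.Subgraph}

/-- The inclusion of a graph into its electrification. -/
def toElectrification (G : SimpleGraph V) (H : C → G.Subgraph) : G →g electrification G H where
  toFun := Sum.inl
  map_rel' h := h

lemma electrification_connected (hG : G.Connected) (hH : ∀ c, (H c).Connected) :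
    (electrification G H).Connected := by
  have : Nonempty V := hG.nonempty
  obtain ⟨o⟩ := this
  have : Nonempty (V ⊕ C) := ⟨.inl o⟩
  refine connected_iff_exists_forall_reachable _ |>.2 ⟨.inl o, ?_⟩
  rintro (x | c)
  · exact (hG.preconnected o x).map (toElectrification G H)
  · obtain ⟨x, hx⟩ := (hH c).nonempty
    refine ((hG.preconnected o x).map (toElectrification G H)).trans (Adj.reachable ?_)
    exact hx

lemma dist_inl_le (hG : G.Connected) (x y : V) :
    (electrification G H).dist (.inl x) (.inl y) ≤ G.dist x y := by
  obtain ⟨γ, hγ⟩ := hG.exists_walk_length_eq_dist x y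
  rw [← hγ]
  exact ((electrification G H).dist_le (γ.map (toElectrification G H))).trans (by simp)

lemma linked_inl (hG : G.Connected) (c : C) {x y : V} {n : ℕ} (h : G.dist x y ≤ n) :
    Linked (electrification G H) (.inr c) n (.inl x) (.inl y) := by
  obtain ⟨γ, hγ⟩ := hG.exists_walk_length_eq_dist x y
  refine ⟨γ.map (toElectrification G H), (Walk.length_map _ _).trans_le (hγ.trans_le h), ?_⟩
  simp [Walk.support_map, toElectrification]

lemma linked_inl_of_ne {c e : C} (hce : c ≠ e) {x y : V} (hx : x ∈ (H e).verts)
    (hy : y ∈ (H e).verts) : Linked (electrification G H) (.inr c) 2 (.inl x) (.inl y) := by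
  have h1 : (electrification G H).Adj (.inl x) (.inr e) := hx
  have h2 : (electrification G H).Adj (.inr e) (.inl y) := hy
  exact ⟨.cons h1 (.cons h2 .nil), by simp, by simpa using hce⟩

lemma dist_le_dist_coe {S : G.Subgraph} (hS : S.Connected) (x y : S.verts) :
    G.dist x y ≤ S.coe.dist x y := by
  obtain ⟨γ, hγ⟩ := hS.coe.exists_walk_length_eq_dist x y
  rw [← hγ]
  exact (G.dist_le (γ.map S.hom)).trans (Walk.length_map _ _).le

/-- Walks of bounded length are quasi-geodesics. -/
lemma isQuasiGeodesic_of_length_le {W : Type*} {E : SimpleGraph W} {p q : W} (γ : E.Walk p q)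
    {L : ℝ} (hL : 1 ≤ L) (h : (γ.length : ℝ) ≤ L) : IsQuasiGeodesic L γ := by
  intro i j hi hj
  have hi' : (i : ℝ) ≤ L := le_trans (by exact_mod_cast hi) h
  have hj' : (j : ℝ) ≤ L := le_trans (by exact_mod_cast hj) h
  have h0i : (0 : ℝ) ≤ i := i.cast_nonneg
  have h0j : (0 : ℝ) ≤ j := j.cast_nonneg
  have habs : |(i : ℝ) - j| ≤ L := abs_le.2 ⟨by linarith, by linarith⟩
  constructor
  · have : |(i : ℝ) - j| / L ≤ 1 := (div_le_one (by linarith)).2 habs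
    have : (0 : ℝ) ≤ E.dist (γ.getVert i) (γ.getVert j) := Nat.cast_nonneg _
    linarith
  · have hd : (E.dist (γ.getVert i) (γ.getVert j) : ℝ) ≤ |(i : ℝ) - j| := by
      rcases le_total i j with hij | hij
      · have := dist_getVert_le_of_le γ hij
        rw [abs_sub_comm, ← Nat.cast_sub hij, Nat.abs_cast]
        exact_mod_cast this
      · have := dist_getVert_le_of_le γ hij
        rw [E.dist_comm, ← Nat.cast_sub hij, Nat.abs_cast]
        exact_mod_cast this
    have := mul_le_mul_of_nonneg_right hL (abs_nonneg ((i : ℝ) - j))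
    linarith

lemma isEfficient_of_isPath {p q : V ⊕ C} {γ : (electrification G H).Walk p q} (h : γ.IsPath) :
    IsEfficient γ := fun _ _ _ hi hj hic hjc ↦ h.getVert_injOn hi hj (hic.trans hjc.symm)

/-- `P` is a fineness function: two vertices of `H c` that can be joined in the electrification by
a walk of length at most `n` avoiding `v_c` have distance at most `P n` in `H c`. -/
def IsFine (G : SimpleGraph V) (H : C → G.Subgraph) (P : ℕ → ℕ) : Prop :=
  ∀ (n : ℕ) (c : C) (x y : (H c).verts),
    Linked (electrification G H) (.inr c) n (.inl x) (.inl y) → (H c).coe.dist x y ≤ P n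

/-- Bounded penetration is only needed for walks of bounded length: it is applied to `x, v_c, y`
and to a path from `x` to `y` that misses `v_c`. -/
lemma BoundedPenetration.exists_isFine (h : BoundedPenetration G H) : ∃ P, IsFine G H P := by
  classical
  choose P hP using fun n : ℕ ↦ h ((n : ℝ) + 2) (by linarith [n.cast_nonneg (α := ℝ)])
  refine ⟨fun n ↦ ⌈P n⌉₊, fun n c x y ⟨γ, hγ, hc⟩ ↦ ?_⟩
  by_contra! hlt
  rcases eq_or_ne x y with rfl | hxy
  · simp at hlt
  have h1 : (electrification G H).Adj (.inl x) (.inr c) := x.2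
  have h2 : (electrification G H).Adj (.inr c) (.inl y) := y.2
  have hxy' : (x : V) ≠ y := fun h ↦ hxy (Subtype.ext h)
  have hn : (0 : ℝ) ≤ n := n.cast_nonneg
  have hlen : (γ.bypass.length : ℝ) ≤ n := by
    exact_mod_cast γ.length_bypass_le_length.trans hγ
  refine hc (γ.support_bypass_subset_support ((hP n).2 _ _ (.cons h1 (.cons h2 .nil))
    (isEfficient_of_isPath ?_) (isQuasiGeodesic_of_length_le _ (by linarith) ?_) c 0 x y
    ⟨rfl, rfl, rfl⟩ ?_ γ.bypass (isEfficient_of_isPath γ.bypass_isPath)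
    (isQuasiGeodesic_of_length_le _ (by linarith) (by linarith))).1)
  · simp [Walk.cons_isPath_iff, hxy']
  · simp
  · exact (Nat.lt_of_ceil_lt hlt).le

/-- A geodesic of the electrification whose endpoints are close in `G` stays close to its
starting point in `G`. -/
lemma IsFine.dist_getVert_le {P : ℕ → ℕ} (hP : IsFine G H P) (hG : G.Connected)
    (hH : ∀ c, (H c).Connected) {x y : V} {r : ℕ} (hr : G.dist x y ≤ r)
    {w : (electrification G H).Walk (.inl x) (.inl y)}
    (hw : w.length = (electrification G H).dist (.inl x) (.inl y)) :
    ∀ i ≤ w.length, ∀ u : V, w.getVert i = .inl u → G.dist x u ≤ i * (P (3 * r) + 1) := by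
  have hE := electrification_connected hG hH
  have hwr : w.length ≤ r := hw.le.trans ((dist_inl_le hG x y).trans hr)
  intro i
  induction i using Nat.strong_induction_on with
  | _ i ih =>
  intro hi u hu
  rcases i with _ | i
  · rw [Walk.getVert_zero] at hu
    simp [Sum.inl.inj hu]
  have hadj := w.adj_getVert_succ (i := i) (by omega)
  rw [hu] at hadj
  rcases hv : w.getVert i with v | e
  · rw [hv] at hadj
    have h1 : G.dist v u = 1 := dist_eq_one_iff_adj.2 hadj
    have h2 := ih i (by omega) (by omega) v hv
    have h3 := hG.dist_triangle (u := x) (v := v) (w := u)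
    have : (i + 1) * (P (3 * r) + 1) = i * (P (3 * r) + 1) + P (3 * r) + 1 := by ring
    omega
  · rw [hv] at hadj
    rcases i with _ | i
    · rw [Walk.getVert_zero] at hv
      cases hv
    have hadj' := w.adj_getVert_succ (i := i) (by omega)
    rw [hv] at hadj'
    rcases hv' : w.getVert i with v | e'
    · rw [hv'] at hadj'
      have hne : ∀ k ≤ w.length, k ≠ i + 1 → w.getVert k ≠ .inr e := fun k hk hki h ↦
        hki ((w.isPath_of_length_eq_dist hw).getVert_injOn hk (show i + 1 ≤ w.length by omega)
          (h.trans hv.symm))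
      -- Go back along `w` to `x`, then to `y` inside `G`, and back along `w`.
      have l1 := Linked.segment w (Nat.zero_le i) (by omega) (z := .inr e)
        fun k _ hk ↦ hne k (by omega) (by omega)
      have l2 := Linked.segment w hi le_rfl (z := .inr e)
        fun k hk hk' ↦ hne k (by omega) (by omega)
      rw [hv', Walk.getVert_zero] at l1
      rw [hu, Walk.getVert_length] at l2
      have h1 := hP (3 * r) e ⟨v, hadj'⟩ ⟨u, hadj⟩
        (((l1.symm.trans (linked_inl hG e hr)).trans l2.symm).mono (by omega))
      have h2 := ih i (by omega) (by omega) v hv'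
      have h3 := hG.dist_triangle (u := x) (v := v) (w := u)
      have h4 : G.dist v u ≤ _ := dist_le_dist_coe (hH e) ⟨v, hadj'⟩ ⟨u, hadj⟩
      have : (i + 1 + 1) * (P (3 * r) + 1)
        = i * (P (3 * r) + 1) + (P (3 * r) + 1) + (P (3 * r) + 1) := by ring
      omega
    · rw [hv'] at hadj'
      exact hadj'.elim

/-- Entrance points of electric geodesics to `v_c` define a retraction of `G` onto `H c` that is
coarsely Lipschitz, and that collapses all balls of a given radius whose centre is far enough
from `H c` to sets of bounded diameter. The bound `B` does not depend on that radius. -/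
lemma IsFine.exists_contracting_retraction {P : ℕ → ℕ} (hP : IsFine G H P) (hG : G.Connected)
    (hH : ∀ c, (H c).Connected) (hyp : IsHyperbolic (electrification G H)) :
    ∃ (B : ℕ) (M : ℕ → ℕ), ∀ c, ∃ ρ : V → (H c).verts, (∀ h : (H c).verts, ρ h = h) ∧
      (∀ x y, G.Adj x y → (H c).coe.dist (ρ x) (ρ y) ≤ B) ∧
      ∀ r x y, G.dist x y ≤ r → (∀ h : (H c).verts, M r < G.dist x h) →
        (H c).coe.dist (ρ x) (ρ y) ≤ B := by
  have hE := electrification_connected hG hH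
  obtain ⟨D, hD⟩ := hyp.exists_fourPoint
  refine ⟨P (32 * D + 4), fun r ↦ r * (P (3 * r) + 1), fun c ↦ ?_⟩
  have hex : ∀ x : V, ∃ p : (electrification G H).Walk (.inr c) (.inl x),
      p.length = (electrification G H).dist (.inr c) (.inl x) ∧
      ∃ h : (H c).verts, p.getVert 1 = .inl h := by
    intro x
    obtain ⟨p, hp⟩ := hE.exists_walk_length_eq_dist (.inr c) (.inl x)
    have hpos : 0 < p.length := by
      rw [hp]
      exact hE.pos_dist_of_ne (by simp)
    have hadj := p.adj_getVert_succ hpos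
    rw [Walk.getVert_zero] at hadj
    rcases hv : p.getVert 1 with h | e
    · rw [zero_add, hv] at hadj
      exact ⟨p, hp, ⟨h, hadj⟩, hv⟩
    · rw [zero_add, hv] at hadj
      exact hadj.elim
  choose p hp ρ hρ using hex
  have key : ∀ x y (w : (electrification G H).Walk (.inl x) (.inl y)),
      w.length = (electrification G H).dist (.inl x) (.inl y) → Sum.inr c ∉ w.support →
      (H c).coe.dist (ρ x) (ρ y) ≤ P (32 * D + 4) := by
    intro x y w hw hc
    refine hP _ c _ _ ?_
    rw [← hρ x, ← hρ y]
    exact hD.linked_first_step hE (hp x) (hp y) hw hc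
  refine ⟨ρ, fun h ↦ ?_, fun x y hxy ↦ ?_, fun r x y hr hM ↦ ?_⟩
  · have hadj : (electrification G H).Adj (.inr c) (.inl h) := h.2
    have hlen : (p h).length = 1 := by rw [hp, dist_eq_one_iff_adj.2 hadj]
    have h1 := (p h).getVert_length
    rw [hlen, hρ] at h1
    exact Subtype.ext (Sum.inl.inj h1)
  · have hadj : (electrification G H).Adj (.inl x) (.inl y) := hxy
    exact key x y (.cons hadj .nil) (by simp [dist_eq_one_iff_adj.2 hadj]) (by simp)
  · obtain ⟨w, hw⟩ := hE.exists_walk_length_eq_dist (.inl x : V ⊕ C) (.inl y)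
    refine key x y w hw fun hc ↦ ?_
    obtain ⟨k, hk, hk'⟩ := Walk.mem_support_iff_exists_getVert.1 hc
    rcases k with _ | k
    · rw [Walk.getVert_zero] at hk
      cases hk
    have hadj := w.adj_getVert_succ (i := k) (by omega)
    rw [hk] at hadj
    rcases hv : w.getVert k with v | e
    · rw [hv] at hadj
      have h1 := hP.dist_getVert_le hG hH hr hw k (by omega) v hv
      have h2 : G.dist x v > _ := hM ⟨v, hadj⟩
      have h3 : k ≤ r := by
        have := (dist_inl_le (H := H) hG x y).trans hr
        omega
      have := Nat.mul_le_mul_right (P (3 * r) + 1) h3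
      simp only at h2
      omega
    · rw [hv] at hadj
      exact hadj.elim

end Electrification

section Projections

variable {V C : Type*} {G : SimpleGraph V} {H : C → G.Subgraph}

/-! ### Quasiconvexity of the peripheral subgraphs -/

/-- Every vertex on a geodesic of `G` with endpoints in `S` has distance at most `Q` from `S`. -/
def IsQuasiconvex (G : SimpleGraph V) (S : G.Subgraph) (Q : ℕ) : Prop :=
  ∀ (p q : S.verts) (u : V), G.dist p u + G.dist u q = G.dist p q →
    ∃ h : S.verts, G.dist u h ≤ Q

lemma dist_le_mul_of_adj {W : Type*} {E : SimpleGraph W} (hG : G.Connected) (hE : E.Connected)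
    {ρ : V → W} {B : ℕ} (hρ : ∀ x y, G.Adj x y → E.dist (ρ x) (ρ y) ≤ B) (x y : V) :
    E.dist (ρ x) (ρ y) ≤ G.dist x y * B := by
  obtain ⟨γ, hγ⟩ := hG.exists_walk_length_eq_dist x y
  rw [← hγ]
  clear hγ
  induction γ with
  | nil => simp
  | cons h γ ih =>
    have h1 := hρ _ _ h
    refine hE.dist_triangle.trans ((Nat.add_le_add h1 ih).trans ?_)
    rw [Walk.length_cons]
    linarith

/-- A geodesic excursion away from `S` of length `ℓ` is shrunk by `ρ` by a factor of two, up to an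
additive error, while its endpoints are moved by `ρ` by a bounded amount; so `ℓ` is bounded. -/
lemma isQuasiconvex_of_retraction {S : G.Subgraph} (hG : G.Connected) (hS : S.Connected)
    {B M : ℕ} {ρ : V → S.verts} (hρ : ∀ h : S.verts, ρ h = h)
    (hlip : ∀ x y, G.Adj x y → S.coe.dist (ρ x) (ρ y) ≤ B)
    (hcon : ∀ x y, G.dist x y ≤ 2 * B + 1 → (∀ h : S.verts, M < G.dist x h) →
      S.coe.dist (ρ x) (ρ y) ≤ B) :
    IsQuasiconvex G S (5 * M + 4 * (M * B) + 4 * B) := by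
  classical
  intro p q u hu
  by_cases hfar : ∃ h : S.verts, G.dist u h ≤ M
  · obtain ⟨h, hh⟩ := hfar
    exact ⟨h, by omega⟩
  obtain ⟨γ₁, hγ₁⟩ := hG.exists_walk_length_eq_dist (p : V) u
  obtain ⟨γ₂, hγ₂⟩ := hG.exists_walk_length_eq_dist u (q : V)
  obtain ⟨γ, hγ, k, hk, hku⟩ : ∃ γ : G.Walk (p : V) q, γ.length = G.dist p q ∧
      ∃ k ≤ γ.length, γ.getVert k = u :=
    ⟨γ₁.append γ₂, by rw [Walk.length_append]; omega, γ₁.length,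
      by rw [Walk.length_append]; omega, by simp [Walk.getVert_append]⟩
  have hnear₀ : ∃ h : S.verts, G.dist (γ.getVert 0) h ≤ M := ⟨p, by simp⟩
  have hnear₁ : ∃ j, k ≤ j ∧ j ≤ γ.length ∧ ∃ h : S.verts, G.dist (γ.getVert j) h ≤ M :=
    ⟨γ.length, hk, le_rfl, q, by simp⟩
  -- The last time before `k` and the first time after `k` at which `γ` is close to `S`.
  obtain ⟨a, hak, ⟨h₁, hh₁⟩, hamax⟩ : ∃ a ≤ k, (∃ h : S.verts, G.dist (γ.getVert a) h ≤ M) ∧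
      ∀ j, a < j → j ≤ k → ¬ ∃ h : S.verts, G.dist (γ.getVert j) h ≤ M :=
    ⟨_, Nat.findGreatest_le k,
      Nat.findGreatest_spec (P := fun j ↦ ∃ h : S.verts, G.dist (γ.getVert j) h ≤ M)
        (Nat.zero_le k) hnear₀, fun j h1 h2 ↦ Nat.findGreatest_is_greatest h1 h2⟩
  obtain ⟨b, hkb, hb, ⟨h₂, hh₂⟩, hbmin⟩ : ∃ b, k ≤ b ∧ b ≤ γ.length ∧
      (∃ h : S.verts, G.dist (γ.getVert b) h ≤ M) ∧
      ∀ j, k ≤ j → j < b → ¬ ∃ h : S.verts, G.dist (γ.getVert j) h ≤ M :=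
    ⟨_, (Nat.find_spec hnear₁).1, (Nat.find_spec hnear₁).2.1, (Nat.find_spec hnear₁).2.2,
      fun j h1 h2 h3 ↦ Nat.find_min hnear₁ h2
        ⟨h1, h2.le.trans (Nat.find_spec hnear₁).2.1, h3⟩⟩
  have hfar' : ∀ j, a < j → j < b → ∀ h : S.verts, M < G.dist (γ.getVert j) h := by
    intro j h1 h2 h
    by_contra! hle
    rcases le_total j k with hjk | hjk
    · exact hamax j h1 hjk ⟨h, hle⟩
    · exact hbmin j hjk h2 ⟨h, hle⟩
  have hab : a < b := by
    refine (hak.lt_of_ne fun h ↦ hfar ?_).trans_le hkb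
    subst h
    exact ⟨h₁, hku ▸ hh₁⟩
  have hstep : ∀ t, a + 1 + t * (2 * B + 1) ≤ b →
      S.coe.dist (ρ (γ.getVert (a + 1))) (ρ (γ.getVert (a + 1 + t * (2 * B + 1)))) ≤ t * B := by
    intro t
    induction t with
    | zero => simp
    | succ t ih =>
      intro ht
      have e : (t + 1) * (2 * B + 1) = t * (2 * B + 1) + (2 * B + 1) := by ring
      have e' : (t + 1) * B = t * B + B := by ring
      have h1 := ih (by omega)
      have h2 := hcon (γ.getVert (a + 1 + t * (2 * B + 1)))
        (γ.getVert (a + 1 + (t + 1) * (2 * B + 1)))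
        ((dist_getVert_le_of_le γ (by omega)).trans (by omega)) (hfar' _ (by omega) (by omega))
      have h3 := hS.coe.dist_triangle (u := ρ (γ.getVert (a + 1)))
        (v := ρ (γ.getVert (a + 1 + t * (2 * B + 1))))
        (w := ρ (γ.getVert (a + 1 + (t + 1) * (2 * B + 1))))
      omega
  have hρab : 2 * S.coe.dist (ρ (γ.getVert a)) (ρ (γ.getVert b)) ≤ (b - a) + 4 * B := by
    have h1 := hlip _ _ (γ.adj_getVert_succ (i := a) (by omega))
    obtain ⟨t, ht, ht'⟩ : ∃ t, t * (2 * B + 1) ≤ b - (a + 1) ∧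
        b - (a + 1) < t * (2 * B + 1) + (2 * B + 1) := by
      refine ⟨(b - (a + 1)) / (2 * B + 1), Nat.div_mul_le_self _ _, ?_⟩
      have := Nat.lt_div_mul_add (a := b - (a + 1)) (b := 2 * B + 1) (by omega)
      omega
    have h2 := hstep t (by omega)
    have h3 : S.coe.dist (ρ (γ.getVert (a + 1 + t * (2 * B + 1)))) (ρ (γ.getVert b)) ≤ B := by
      rcases (show a + 1 + t * (2 * B + 1) ≤ b by omega).eq_or_lt with h | h
      · rw [h]; simp
      · exact hcon _ _ ((dist_getVert_le_of_le γ h.le).trans (by omega))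
          (hfar' _ (by omega) h)
    have h4 := hS.coe.dist_triangle (u := ρ (γ.getVert a)) (v := ρ (γ.getVert (a + 1)))
      (w := ρ (γ.getVert b))
    have h5 := hS.coe.dist_triangle (u := ρ (γ.getVert (a + 1)))
      (v := ρ (γ.getVert (a + 1 + t * (2 * B + 1)))) (w := ρ (γ.getVert b))
    have e : t * (2 * B + 1) = 2 * (t * B) + t := by ring
    omega
  have hmove : ∀ (x : V) (h : S.verts), G.dist x h ≤ M → G.dist x (ρ x) ≤ M + M * B := by
    intro x h hx
    have h1 := dist_le_mul_of_adj hG hS.coe hlip x h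
    rw [hρ] at h1
    have h2 := dist_le_dist_coe hS (ρ x) h
    have h3 := hG.dist_triangle (u := x) (v := (h : V)) (w := ρ x)
    rw [G.dist_comm (u := (h : V))] at h3
    have h4 := Nat.mul_le_mul_right B hx
    omega
  have hlen : b - a ≤ 4 * M + 4 * (M * B) + 4 * B := by
    have h1 := hmove _ _ hh₁
    have h2 := hmove _ _ hh₂
    have h3 := dist_getVert_eq_sub hG hγ hab.le hb
    have h4 := hG.dist_triangle (u := γ.getVert a) (v := (ρ (γ.getVert a) : V))
      (w := γ.getVert b)
    have h5 := hG.dist_triangle (u := (ρ (γ.getVert a) : V)) (v := (ρ (γ.getVert b) : V))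
      (w := γ.getVert b)
    have h6 := dist_le_dist_coe hS (ρ (γ.getVert a)) (ρ (γ.getVert b))
    rw [G.dist_comm (u := (ρ (γ.getVert b) : V))] at h5
    omega
  have h1 := dist_getVert_le_of_le γ hak
  have h2 := hG.dist_triangle (u := γ.getVert k) (v := γ.getVert a) (w := (h₁ : V))
  rw [G.dist_comm (u := γ.getVert k) (v := γ.getVert a)] at h2
  rw [hku] at h1 h2
  exact ⟨h₁, by omega⟩

/-! ### Projections to quasiconvex subgraphs of a hyperbolic graph -/

/-- The additive error in the reverse triangle inequality for projections to quasiconvex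
subgraphs. -/
def projError (D Q K : ℕ) : ℕ := 2 * (K + Q + 2 * D + 1)

lemma IsProjection.dist_add_dist_le {S : G.Subgraph} {K Q D : ℕ} {π : V → S.verts}
    (hπ : IsProjection S K π) (hG : G.Connected) (hD : FourPoint G D)
    (hQ : IsQuasiconvex G S Q) (x : V) (p : S.verts) :
    G.dist x (π x) + G.dist (π x : V) p ≤ G.dist x p + projError D Q K := by
  unfold projError
  rcases le_or_gt (G.dist (π x : V) p) (K + Q + 2 * D + 1) with hs | hs
  · have h1 := hG.dist_triangle (u := x) (v := (p : V)) (w := (π x : V))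
    rw [G.dist_comm (u := (p : V))] at h1
    omega
  -- The point at distance `K + Q + 2 * D + 1` from `π x` on a geodesic to `p` is too close to `S`
  -- for `x` to reach it along a geodesic passing near `π x`.
  obtain ⟨γ, hγ⟩ := hG.exists_walk_length_eq_dist (π x : V) p
  have h1 := dist_start_getVert hG hγ (i := K + Q + 2 * D + 1) (by omega)
  have h2 := dist_getVert_end hG hγ (i := K + Q + 2 * D + 1) (by omega)
  generalize γ.getVert (K + Q + 2 * D + 1) = u at h1 h2
  obtain ⟨h, hh⟩ := hQ (π x) p u (by omega)
  have h3 := hπ x h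
  have h4 := hG.dist_triangle (u := x) (v := u) (w := (h : V))
  have h5 := hD x u (π x) p
  rw [G.dist_comm (u := u) (v := (π x : V))] at h5
  omega

lemma IsProjection.dist_add_dist_add_dist_le {S : G.Subgraph} {K Q D : ℕ} {π : V → S.verts}
    (hπ : IsProjection S K π) (hG : G.Connected) (hD : FourPoint G D)
    (hQ : IsQuasiconvex G S Q) (x y : V)
    (hxy : projError D Q K + D < G.dist (π x : V) (π y)) :
    G.dist x (π x) + G.dist (π x : V) (π y) + G.dist (π y : V) y ≤
      G.dist x y + (2 * projError D Q K + 2 * D) := by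
  have h1 := hπ.dist_add_dist_le hG hD hQ x (π y)
  have h2 := hπ.dist_add_dist_le hG hD hQ y (π x)
  have h3 := hD x (π y) y (π x)
  rw [G.dist_comm (u := (π y : V)) (v := (π x : V))] at h2 h3
  rw [G.dist_comm (u := y) (v := (π y : V))] at h2
  omega

/-- If the projections of `x` and `y` are far apart, then a geodesic from `x` to `y` passes close to
both projections. -/
lemma IsProjection.exists_near_getVert {S : G.Subgraph} {K Q D : ℕ} {π : V → S.verts}
    (hπ : IsProjection S K π) (hG : G.Connected) (hD : FourPoint G D)
    (hQ : IsQuasiconvex G S Q) {x y : V} {γ : G.Walk x y} (hγ : γ.length = G.dist x y)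
    (hxy : projError D Q K + D < G.dist (π x : V) (π y)) :
    (∃ i ≤ γ.length, G.dist (π x : V) (γ.getVert i) ≤ 2 * projError D Q K + 4 * D) ∧
      ∃ j ≤ γ.length, G.dist (π y : V) (γ.getVert j) ≤ 2 * projError D Q K + 4 * D := by
  have h := hπ.dist_add_dist_add_dist_le hG hD hQ x y hxy
  have h1 := hG.dist_triangle (u := (π x : V)) (v := (π y : V)) (w := y)
  have h2 := hG.dist_triangle (u := x) (v := (π x : V)) (w := (π y : V))
  obtain ⟨i, hi, hi'⟩ := hD.exists_near_getVert hG hγ (u := (π x : V))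
    (m := 2 * projError D Q K + 2 * D) (by omega)
  obtain ⟨j, hj, hj'⟩ := hD.exists_near_getVert hG hγ (u := (π y : V))
    (m := 2 * projError D Q K + 2 * D) (by omega)
  exact ⟨⟨i, hi, by omega⟩, j, hj, by omega⟩

/-! ### Projections between different peripheral subgraphs -/

/-- Different peripheral subgraphs stay close to each other only along sets of bounded diameter. -/
lemma IsFine.dist_le_of_near {P : ℕ → ℕ} (hP : IsFine G H P) (hG : G.Connected) {c e : C}
    (hce : c ≠ e) {r : ℕ} (w w' : (H c).verts) (u u' : (H e).verts)
    (hwu : G.dist (w : V) u ≤ r) (hwu' : G.dist (w' : V) u' ≤ r) :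
    (H c).coe.dist w w' ≤ P (2 * r + 2) :=
  hP _ c w w' <| (((linked_inl hG c hwu).trans (linked_inl_of_ne hce u.2 u'.2)).trans
    (linked_inl hG c hwu').symm).mono (by omega)

lemma IsFine.lt_dist_of_lt_dist_coe {P : ℕ → ℕ} (hP : IsFine G H P) (hG : G.Connected) {c : C}
    {n : ℕ} {x y : (H c).verts} (h : P n < (H c).coe.dist x y) : n < G.dist (x : V) y := by
  by_contra! hle
  exact h.not_ge (hP n c x y (linked_inl hG c hle))

lemma IsFine.dist_proj_le {P : ℕ → ℕ} (hP : IsFine G H P) (hG : G.Connected) {D Q K : ℕ}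
    (hD : FourPoint G D) (hQ : ∀ c, IsQuasiconvex G (H c) Q) {c e : C} (hce : c ≠ e)
    {π : V → (H c).verts} (hπ : IsProjection (H c) K π) (x y : (H e).verts) :
    (H c).coe.dist (π x) (π y) ≤ max (P (projError D Q K + D))
      (P (2 * (2 * projError D Q K + 4 * D + Q) + 2)) := by
  by_contra! hlt
  obtain ⟨hlt₁, hlt₂⟩ := max_lt_iff.1 hlt
  obtain ⟨γ, hγ⟩ := hG.exists_walk_length_eq_dist (x : V) y
  obtain ⟨⟨i, hi, hi'⟩, j, hj, hj'⟩ :=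
    hπ.exists_near_getVert hG hD (hQ c) hγ (hP.lt_dist_of_lt_dist_coe hG hlt₁)
  have hnear : ∀ i ≤ γ.length, ∃ h : (H e).verts, G.dist (γ.getVert i) h ≤ Q := fun i hi ↦
    hQ e x y _ (by rw [dist_start_getVert hG hγ hi, dist_getVert_end hG hγ hi]; omega)
  obtain ⟨u, hu⟩ := hnear i hi
  obtain ⟨u', hu'⟩ := hnear j hj
  refine hlt₂.not_ge (hP.dist_le_of_near hG hce _ _ u u' ?_ ?_)
  · exact hG.dist_triangle.trans (Nat.add_le_add hi' hu)
  · exact hG.dist_triangle.trans (Nat.add_le_add hj' hu')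

/-- Behrstock's inequality: if `π_a` separates `y` from its projection `π_b y`, then a geodesic
from `y` to `π_b y` passes near `π_a y`, so that `π_a y` has almost the same projection to `H b`
as `y`. -/
lemma IsFine.dist_proj_proj_le {P : ℕ → ℕ} (hP : IsFine G H P) (hG : G.Connected) {D Q K : ℕ}
    (hD : FourPoint G D) (hQ : ∀ c, IsQuasiconvex G (H c) Q) {a b : C}
    {πa : V → (H a).verts} (hπa : IsProjection (H a) K πa)
    {πb : V → (H b).verts} (hπb : IsProjection (H b) K πb) (y : V)
    (h : P (projError D Q K + D) < (H a).coe.dist (πa y) (πa (πb y))) :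
    (H b).coe.dist (πb (πa y)) (πb y) ≤ P (3 * projError D Q K + 2 * D + K) := by
  refine hP _ b _ _ (linked_inl hG b ?_)
  have h1 := hπa.dist_add_dist_add_dist_le hG hD (hQ a) y (πb y) (hP.lt_dist_of_lt_dist_coe hG h)
  have h2 := hπb.dist_add_dist_le hG hD (hQ b) (πa y) (πb y)
  have h3 := hπb y (πb (πa y))
  have h4 := hG.dist_triangle (u := y) (v := (πa y : V)) (w := (πb (πa y) : V))
  have h5 := hG.dist_triangle (u := (πa y : V)) (v := (πa (πb y) : V)) (w := (πb y : V))
  omega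

/-- A fixed geodesic from `x` to `y` records, for every `c` with `π_c x` and `π_c y` far apart, two
vertices near these projections. Different `c` cannot have the same record. -/
lemma IsFine.finite_setOf_lt_dist_proj {P : ℕ → ℕ} (hP : IsFine G H P) (hG : G.Connected)
    {D Q K : ℕ} (hD : FourPoint G D) (hQ : ∀ c, IsQuasiconvex G (H c) Q)
    {π : ∀ c, V → (H c).verts} (hπ : ∀ c, IsProjection (H c) K (π c)) (x y : V) {T : ℕ}
    (hT : P (projError D Q K + D) ≤ T)
    (hT' : P (2 * (2 * (2 * projError D Q K + 4 * D)) + 2) ≤ T) :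
    {c : C | T < (H c).coe.dist (π c x) (π c y)}.Finite := by
  obtain ⟨γ, hγ⟩ := hG.exists_walk_length_eq_dist x y
  have hex : ∀ c, T < (H c).coe.dist (π c x) (π c y) → ∃ ij : ℕ × ℕ,
      (ij.1 ≤ γ.length ∧ ij.2 ≤ γ.length) ∧
      G.dist (π c x : V) (γ.getVert ij.1) ≤ 2 * projError D Q K + 4 * D ∧
      G.dist (π c y : V) (γ.getVert ij.2) ≤ 2 * projError D Q K + 4 * D := by
    intro c hc
    obtain ⟨⟨i, hi, hi'⟩, j, hj, hj'⟩ := (hπ c).exists_near_getVert hG hD (hQ c) hγ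
      (hP.lt_dist_of_lt_dist_coe hG (hT.trans_lt hc))
    exact ⟨(i, j), ⟨hi, hj⟩, hi', hj'⟩
  choose! f hf hfx hfy using hex
  refine Set.Finite.of_injOn (f := f) (t := Set.Iic γ.length ×ˢ Set.Iic γ.length)
    (fun c hc ↦ hf c hc) (fun c hc e he hfe ↦ ?_) ((Set.finite_Iic _).prod (Set.finite_Iic _))
  by_contra hce
  refine (hT'.trans_lt hc).not_ge (hP.dist_le_of_near hG hce _ _ (π e x) (π e y) ?_ ?_)
  · have h1 := hfx c hc
    have h2 := hfx e he
    have h3 := hG.dist_triangle (u := (π c x : V)) (v := γ.getVert (f c).1) (w := (π e x : V))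
    rw [G.dist_comm, ← hfe] at h2
    omega
  · have h1 := hfy c hc
    have h2 := hfy e he
    have h3 := hG.dist_triangle (u := (π c y : V)) (v := γ.getVert (f c).2) (w := (π e y : V))
    rw [G.dist_comm, ← hfe] at h2
    omega

lemma setDiam_le_iff {W : Type*} {E : SimpleGraph W} (hE : E.Connected) {S : Set W} {n : ℕ} :
    setDiam E S ≤ n ↔ ∀ x ∈ S, ∀ y ∈ S, E.dist x y ≤ n := by
  simp only [setDiam, iSup_le_iff, ← (hE.preconnected _ _).coe_dist_eq_edist, Nat.cast_le]

/-- If projections between different peripheral subgraphs have diameter at most `R`, then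
`d_c(a, b)` can be computed from one point of `H a` and one point of `H b`. -/
lemma projDist_le (hH : ∀ c, (H c).Connected) {π : ∀ c, V → (H c).verts} {R T : ℕ}
    (hR : ∀ c e, c ≠ e → ∀ x y : (H e).verts, (H c).coe.dist (π c x) (π c y) ≤ R)
    {a b c : C} (hca : c ≠ a) (hcb : c ≠ b) (x : (H a).verts) (y : (H b).verts)
    (hT : (H c).coe.dist (π c x) (π c y) ≤ T) : projDist H π c a b ≤ (T + 2 * R : ℕ) := by
  refine (setDiam_le_iff (hH c).coe).2 ?_
  have hcomm := fun u v ↦ (H c).coe.dist_comm (u := u) (v := v)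
  have key : ∀ (x' : (H a).verts) (y' : (H b).verts),
      (H c).coe.dist (π c x') (π c y') ≤ T + 2 * R := by
    intro x' y'
    have h1 := hR c a hca x' x
    have h2 := hR c b hcb y y'
    have h3 := (hH c).coe.dist_triangle (u := π c x') (v := π c x) (w := π c y')
    have h4 := (hH c).coe.dist_triangle (u := π c x) (v := π c y) (w := π c y')
    omega
  rintro _ (⟨x', hx, rfl⟩ | ⟨x', hx, rfl⟩) _ (⟨y', hy, rfl⟩ | ⟨y', hy, rfl⟩)
  · exact (hR c a hca ⟨x', hx⟩ ⟨y', hy⟩).trans (by omega)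
  · exact key ⟨x', hx⟩ ⟨y', hy⟩
  · rw [hcomm]
    exact key ⟨y', hy⟩ ⟨x', hx⟩
  · exact (hR c b hcb ⟨x', hx⟩ ⟨y', hy⟩).trans (by omega)

end Projections

end RelHypGraph

open RelHypGraph in
theorem lemma2p2 {V : Type*} {C : Type*} (G : SimpleGraph V) (H : C → G.Subgraph)
    (hG : RelHypGraph.IsHyperbolic G)
    (hrel : RelHypGraph.IsHyperbolicRelativeTo G H)
    (δ : ℝ) (hδ : 0 < δ) (hH : ∀ c, RelHypGraph.IsDeltaHyperbolic (H c).coe δ)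
    (K : ℕ) :
    ∃ R : ℕ, 0 < R ∧ ∃ θ : ℕ, 0 < θ ∧
      ∀ π : ∀ c, V → (H c).verts, (∀ c, RelHypGraph.IsProjection (H c) K (π c)) →
        (∀ c d : C, c ≠ d →
          RelHypGraph.setDiam (H c).coe (π c '' (H d).verts) ≤ (R : ℕ∞)) ∧
        (∀ a b c : C, a ≠ b → b ≠ c → a ≠ c →
          ¬ ((θ : ℕ∞) < RelHypGraph.projDist H π a b c ∧
              (θ : ℕ∞) < RelHypGraph.projDist H π b a c) ∧
          ¬ ((θ : ℕ∞) < RelHypGraph.projDist H π a b c ∧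
              (θ : ℕ∞) < RelHypGraph.projDist H π c a b) ∧
          ¬ ((θ : ℕ∞) < RelHypGraph.projDist H π b a c ∧
              (θ : ℕ∞) < RelHypGraph.projDist H π c a b)) ∧
        (∀ a b : C, {c : C | (θ : ℕ∞) < RelHypGraph.projDist H π c a b}.Finite) := by
  have hconn := hrel.connected
  have hconn' := hrel.connected_peripheral
  obtain ⟨D, hD⟩ := hG.exists_fourPoint
  obtain ⟨P, hP⟩ := hrel.bounded_penetration.exists_isFine
  obtain ⟨B, M, hρ⟩ :=
    hP.exists_contracting_retraction hconn hconn' hrel.hyperbolic_electrification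
  obtain ⟨Q, hQ⟩ : ∃ Q, ∀ c, IsQuasiconvex G (H c) Q := by
    refine ⟨5 * M (2 * B + 1) + 4 * (M (2 * B + 1) * B) + 4 * B, fun c ↦ ?_⟩
    obtain ⟨ρ, h1, h2, h3⟩ := hρ c
    exact isQuasiconvex_of_retraction hconn (hconn' c) h1 h2 (h3 (2 * B + 1))
  obtain ⟨R, hRpos, hR₁, hR₂⟩ : ∃ R, 0 < R ∧ P (projError D Q K + D) ≤ R ∧
      P (2 * (2 * projError D Q K + 4 * D + Q) + 2) ≤ R :=
    ⟨1 + P (projError D Q K + D) + P (2 * (2 * projError D Q K + 4 * D + Q) + 2),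
      by omega, by omega, by omega⟩
  obtain ⟨T, hT₁, hT₂, hT₃⟩ : ∃ T, P (projError D Q K + D) ≤ T ∧
      P (3 * projError D Q K + 2 * D + K) ≤ T ∧
      P (2 * (2 * (2 * projError D Q K + 4 * D)) + 2) ≤ T :=
    ⟨P (projError D Q K + D) + P (3 * projError D Q K + 2 * D + K) +
      P (2 * (2 * (2 * projError D Q K + 4 * D)) + 2), by omega, by omega, by omega⟩
  refine ⟨R, hRpos, T + 2 * R, by omega, fun π hπ ↦ ?_⟩
  have hproj : ∀ c e, c ≠ e → ∀ x y : (H e).verts, (H c).coe.dist (π c x) (π c y) ≤ R :=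
    fun c e hce x y ↦ (hP.dist_proj_le hconn hD hQ hce (hπ c) x y).trans (max_le hR₁ hR₂)
  have hcomm : ∀ a b c, projDist H π a b c = projDist H π a c b := fun a b c ↦ by
    simp only [projDist, Set.union_comm]
  have behrstock : ∀ a b c : C, a ≠ b → b ≠ c → a ≠ c →
      ¬ (((T + 2 * R : ℕ) : ℕ∞) < projDist H π a b c ∧
        ((T + 2 * R : ℕ) : ℕ∞) < projDist H π b a c) := by
    rintro a b c hab hbc hac ⟨h1, h2⟩
    obtain ⟨y, hy⟩ := (hconn' c).nonempty
    have h3 : T < (H a).coe.dist (π a y) (π a (π b y)) := by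
      rw [SimpleGraph.dist_comm]
      by_contra! hle
      exact h1.not_ge (projDist_le hconn' hproj hab hac (π b y) ⟨y, hy⟩ hle)
    have h4 := hP.dist_proj_proj_le hconn hD hQ (hπ a) (hπ b) y (hT₁.trans_lt h3)
    exact h2.not_ge (projDist_le hconn' hproj hab.symm hbc (π a y) ⟨y, hy⟩ (h4.trans hT₂))
  refine ⟨fun c d hcd ↦ ?_, fun a b c hab hbc hac ↦ ⟨behrstock a b c hab hbc hac, ?_, ?_⟩,
    fun a b ↦ ?_⟩
  · refine (setDiam_le_iff (hconn' c).coe).2 ?_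
    rintro _ ⟨x, hx, rfl⟩ _ ⟨y, hy, rfl⟩
    exact hproj c d hcd ⟨x, hx⟩ ⟨y, hy⟩
  · rw [hcomm a b c]
    exact behrstock a c b hac hbc.symm hab
  · rw [hcomm b a c, hcomm c a b]
    exact behrstock b c a hbc hac.symm hab.symm
  · obtain ⟨x, hx⟩ := (hconn' a).nonempty
    obtain ⟨y, hy⟩ := (hconn' b).nonempty
    refine ((hP.finite_setOf_lt_dist_proj hconn hD hQ hπ x y hT₁ hT₃).union
      (Set.toFinite {a, b})).subset fun c hc ↦ ?_
    by_cases hca : c = a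
    · exact .inr (.inl hca)
    by_cases hcb : c = b
    · exact .inr (.inr hcb)
    refine .inl ?_
    by_contra hle
    exact (show ((T + 2 * R : ℕ) : ℕ∞) < projDist H π c a b from hc).not_ge
      (projDist_le hconn' hproj hca hcb ⟨x, hx⟩ ⟨y, hy⟩ (not_lt.1 hle))
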